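/- **Theorem 5.6.** A *UMTL-algebra* is an algebra $(L,\wedge,\vee,\odot,\to,0,1,\forall)$ such that $(L,\wedge,\vee,0,1)$ is a bounded lattice, $(L,\odot,1)$ is a commutative monoid, $x\odot y\le z \iff x\le y\to z$ and $(x\to y)\vee(y\to x)=1$ (that is, $L$ is an MTL-algebra), and $\forall:L\to L$ satisfies, for all $x,y\in L$, $$\forall x\le x,\qquad \forall\bigl((x\to\forall y)\to\forall y\bigr)=(\forall x\to\forall y)\to\forall y,\qquad \forall(\forall x\to y)=\forall x\to\forall y .$$ It is *linearly ordered* if its lattice order is total. Formulas are built from an arbitrary set of propositional variables and the constant $\overline 0$ by the connectives $\&,\sqcap,\Rightarrow$ and the unary $\square$; one abbreviates $\alpha\sqcup\beta:=((\alpha\Rightarrow\beta)\Rightarrow\beta)\sqcap((\beta\Rightarrow\alpha)\Rightarrow\alpha)$ and $\alpha\equiv\beta:=(\alpha\Rightarrow\beta)\,\&\,(\beta\Rightarrow\alpha)$. The logic $\mathbf{MMTL}$ has the axiom schemes of $\mathbf{MTL}$, 1. $(\alpha\Rightarrow\beta)\Rightarrow((\beta\Rightarrow\gamma)\Rightarrow(\alpha\Rightarrow\gamma))$,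 2. $(\alpha\&\beta)\Rightarrow\alpha$, 3. $(\alpha\&\beta)\Rightarrow(\beta\&\alpha)$, 4. $(\alpha\sqcap\beta)\Rightarrow\alpha$, 5. $(\alpha\sqcap\beta)\Rightarrow(\beta\sqcap\alpha)$, 6. $(\alpha\&(\alpha\Rightarrow\beta))\Rightarrow(\alpha\sqcap\beta)$, 7. $(\alpha\Rightarrow(\beta\Rightarrow\gamma))\Rightarrow((\alpha\&\beta)\Rightarrow\gamma)$, 8. $((\alpha\&\beta)\Rightarrow\gamma)\Rightarrow(\alpha\Rightarrow(\beta\Rightarrow\gamma))$, 9. $((\alpha\Rightarrow\beta)\Rightarrow\gamma)\Rightarrow(((\beta\Rightarrow\alpha)\Rightarrow\gamma)\Rightarrow\gamma)$, 10. $\overline 0\Rightarrow\alpha$, together with the schemes - (M1) $\square\alpha\Rightarrow\alpha$, - (M2) $\square((\alpha\Rightarrow\square\beta)\Rightarrow\square\beta)\equiv((\square\alpha\Rightarrow\square\beta)\Rightarrow\square\beta)$, - (M3) $\square(\square\alpha\Rightarrow\beta)\equiv(\square\alpha\Rightarrow\square\beta)$, and the rules modus ponens (from $\alpha$ and $\alpha\Rightarrow\beta$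 derive $\beta$) and necessitation (from $\alpha$ derive $\square\alpha$). Let $\mathbf{MMTL}_\ell$ be $\mathbf{MMTL}$ plus the disjunction form of the rule $\square$: from $\alpha\sqcup\beta$ derive $\alpha\sqcup\square\beta$. For a set $T$ of formulas (a theory), write $T\vdash_{\mathbf{MMTL}_\ell}\alpha$ if $\alpha$ has a finite derivation from the axioms and the elements of $T$ by these three rules. Then $\mathbf{MMTL}_\ell$ is semilinear, i.e. complete with respect to the class of linearly ordered UMTL-algebras: for every theory $T$ and every formula $\alpha$, $T\vdash_{\mathbf{MMTL}_\ell}\alpha$ if and only if for every linearly ordered UMTL-algebra $(L,\forall)$ and every evaluation $e$ of formulas in $(L,\forall)$ (interpreting $\&,\sqcap,\Rightarrow,\overline 0,\square$ by $\odot,\wedge,\to,0,\forall$) with $e(\psi)=1$ for all $\psi\in T$, one has $e(\alpha)=1$. -/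

import Mathlib

universe u v w

/-- MTL-algebras `(L, ∧, ∨, ⊙, →, 0, 1)`: here `∧, ∨` are `⊓, ⊔`, the bounds `0, 1` are `⊥, ⊤`,
the monoid operation `⊙` is `*` with unit `1`, and the residuum `→` is `⇨`. -/
class MTLAlgebra (L : Type w) extends Lattice L, BoundedOrder L, CommMonoid L, HImp L where
  one_eq_top : (1 : L) = ⊤
  mul_le_iff_le_himp : ∀ x y z : L, x * y ≤ z ↔ x ≤ y ⇨ z
  prelinearity : ∀ x y : L, (x ⇨ y) ⊔ (y ⇨ x) = 1

/-- UMTL-algebras: MTL-algebras with a universal quantifier, written `univ`. -/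
class UMTLAlgebra (L : Type w) extends MTLAlgebra L where
  univ : L → L
  univ_le : ∀ x : L, univ x ≤ x
  univ_himp_himp : ∀ x y : L,
    univ ((x ⇨ univ y) ⇨ univ y) = (univ x ⇨ univ y) ⇨ univ y
  univ_univ_himp : ∀ x y : L, univ (univ x ⇨ y) = univ x ⇨ univ y

/-- Formulas over the set `V` of propositional variables, in the primitive connectives
falsum, strong conjunction `&`, weak (lattice) conjunction, implication, and `□`. -/
inductive ModalFormula (V : Type u) : Type u where
  | var : V → ModalFormula V
  | falsum : ModalFormula V
  | conj : ModalFormula V → ModalFormula V → ModalFormula V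
  | meet : ModalFormula V → ModalFormula V → ModalFormula V
  | imp : ModalFormula V → ModalFormula V → ModalFormula V
  | box : ModalFormula V → ModalFormula V

namespace ModalFormula

infixr:60 " ⇒ₘ " => ModalFormula.imp
infixl:70 " &ₘ " => ModalFormula.conj
infixl:68 " ⊓ₘ " => ModalFormula.meet
prefix:80 "□ₘ" => ModalFormula.box

/-- The defined lattice disjunction. -/
def join {V : Type u} (α β : ModalFormula V) : ModalFormula V :=
  ((α ⇒ₘ β) ⇒ₘ β) ⊓ₘ ((β ⇒ₘ α) ⇒ₘ α)

/-- The defined equivalence. -/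
def equiv {V : Type u} (α β : ModalFormula V) : ModalFormula V :=
  (α ⇒ₘ β) &ₘ (β ⇒ₘ α)

infixl:66 " ⊔ₘ " => ModalFormula.join
infix:55 " ≡ₘ " => ModalFormula.equiv

/-- The value of a formula in a UMTL-algebra under an assignment of the variables. -/
def eval {V : Type u} {L : Type w} [UMTLAlgebra L] (e : V → L) : ModalFormula V → L
  | var p => e p
  | falsum => ⊥
  | conj α β => eval e α * eval e β
  | meet α β => eval e α ⊓ eval e β
  | imp α β => eval e α ⇨ eval e β
  | box α => UMTLAlgebra.univ (eval e α)

/-- The assignment `e` is a model of `T`: every formula of `T` takes the value `1`. -/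
def IsModel {V : Type u} {L : Type w} [UMTLAlgebra L] (e : V → L)
    (T : Set (ModalFormula V)) : Prop :=
  ∀ ψ ∈ T, eval e ψ = 1

end ModalFormula

/-- The axioms of monoidal t-norm based logic MTL. -/
inductive MTLAxiom {V : Type u} : ModalFormula V → Prop where
  | ax1 (α β γ : ModalFormula V) : MTLAxiom ((α ⇒ₘ β) ⇒ₘ ((β ⇒ₘ γ) ⇒ₘ (α ⇒ₘ γ)))
  | ax2 (α β : ModalFormula V) : MTLAxiom ((α &ₘ β) ⇒ₘ α)
  | ax3 (α β : ModalFormula V) : MTLAxiom ((α &ₘ β) ⇒ₘ (β &ₘ α))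
  | ax4 (α β : ModalFormula V) : MTLAxiom ((α ⊓ₘ β) ⇒ₘ α)
  | ax5 (α β : ModalFormula V) : MTLAxiom ((α ⊓ₘ β) ⇒ₘ (β ⊓ₘ α))
  | ax6 (α β : ModalFormula V) : MTLAxiom ((α &ₘ (α ⇒ₘ β)) ⇒ₘ (α ⊓ₘ β))
  | ax7 (α β γ : ModalFormula V) : MTLAxiom ((α ⇒ₘ (β ⇒ₘ γ)) ⇒ₘ ((α &ₘ β) ⇒ₘ γ))
  | ax8 (α β γ : ModalFormula V) : MTLAxiom (((α &ₘ β) ⇒ₘ γ) ⇒ₘ (α ⇒ₘ (β ⇒ₘ γ)))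
  | ax9 (α β γ : ModalFormula V) :
      MTLAxiom (((α ⇒ₘ β) ⇒ₘ γ) ⇒ₘ (((β ⇒ₘ α) ⇒ₘ γ) ⇒ₘ γ))
  | ax10 (α : ModalFormula V) : MTLAxiom (ModalFormula.falsum ⇒ₘ α)

/-- The axioms of modal monoidal t-norm based logic MMTL. -/
inductive MMTLAxiom {V : Type u} : ModalFormula V → Prop where
  | mtl {α : ModalFormula V} : MTLAxiom α → MMTLAxiom α
  | m1 (α : ModalFormula V) : MMTLAxiom (□ₘ α ⇒ₘ α)
  | m2 (α β : ModalFormula V) :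
      MMTLAxiom ((□ₘ ((α ⇒ₘ □ₘ β) ⇒ₘ □ₘ β)) ≡ₘ ((□ₘ α ⇒ₘ □ₘ β) ⇒ₘ □ₘ β))
  | m3 (α β : ModalFormula V) :
      MMTLAxiom ((□ₘ (□ₘ α ⇒ₘ β)) ≡ₘ (□ₘ α ⇒ₘ □ₘ β))

/-- `MMTLl T α`: the formula `α` is derivable from the theory `T` in the logic obtained from MMTL
(axioms as above, rules modus ponens and necessitation) by adding the disjunction form of the
`□`-rule. -/
inductive MMTLl {V : Type u} (T : Set (ModalFormula V)) : ModalFormula V → Prop where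
  | ax {α : ModalFormula V} : MMTLAxiom α → MMTLl T α
  | hyp {α : ModalFormula V} : α ∈ T → MMTLl T α
  | mp {α β : ModalFormula V} : MMTLl T α → MMTLl T (α ⇒ₘ β) → MMTLl T β
  | nec {α : ModalFormula V} : MMTLl T α → MMTLl T (□ₘ α)
  | disjBox {α β : ModalFormula V} : MMTLl T (α ⊔ₘ β) → MMTLl T (α ⊔ₘ □ₘ β)

/-! Soundness is checked in chains: there a join equals `1` only if one joinand does, so the
disjunction rule reduces to `∀1 = 1`. For completeness, suppose `T` does not derive `α`. The
Lindenbaum algebra of any theory is a UMTL-algebra, and it is a chain as soon as the theory derives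
`φ ⇒ ψ` or `ψ ⇒ φ` for every pair. Zorn's lemma extends `T` to a theory maximal among those not
deriving `α`. That such a theory is linear follows from prelinearity and proof by cases
(`proof_by_cases`): if both implications failed, adding either would yield `α`, hence so would their
provable disjunction. Proof by cases rests on `join_of_insert`: every rule stays valid under a side
disjunct `χ`, and for necessitation this is precisely the extra rule. -/

namespace MMTLl

variable {V : Type u} {T : Set (ModalFormula V)} {α β γ δ φ ψ χ : ModalFormula V}

/-! ### Derived rules -/

theorem ofMTL (h : MTLAxiom α) : MMTLl T α := .ax (.mtl h)

theorem trans (h : MMTLl T (α ⇒ₘ β)) (h' : MMTLl T (β ⇒ₘ γ)) : MMTLl T (α ⇒ₘ γ) :=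
  .mp h' (.mp h (ofMTL (.ax1 α β γ)))

theorem curry (h : MMTLl T (α &ₘ β ⇒ₘ γ)) : MMTLl T (α ⇒ₘ β ⇒ₘ γ) :=
  .mp h (ofMTL (.ax8 α β γ))

theorem uncurry (h : MMTLl T (α ⇒ₘ β ⇒ₘ γ)) : MMTLl T (α &ₘ β ⇒ₘ γ) :=
  .mp h (ofMTL (.ax7 α β γ))

theorem conj_left : MMTLl T (α &ₘ β ⇒ₘ α) := ofMTL (.ax2 α β)

theorem conj_comm : MMTLl T (α &ₘ β ⇒ₘ β &ₘ α) := ofMTL (.ax3 α β)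

theorem conj_right : MMTLl T (α &ₘ β ⇒ₘ β) := trans conj_comm conj_left

theorem refl (α : ModalFormula V) : MMTLl T (α ⇒ₘ α) :=
  .mp (curry (conj_left (α := α) (β := α))) (curry conj_right)

theorem weaken (h : MMTLl T β) : MMTLl T (α ⇒ₘ β) := .mp h (curry conj_left)

theorem swap (h : MMTLl T (α ⇒ₘ β ⇒ₘ γ)) : MMTLl T (β ⇒ₘ α ⇒ₘ γ) :=
  curry (trans conj_comm (uncurry h))

theorem conj_mono_left (h : MMTLl T (α ⇒ₘ β)) : MMTLl T (α &ₘ γ ⇒ₘ β &ₘ γ) :=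
  uncurry (trans h (curry (refl _)))

theorem conj_mono (h : MMTLl T (α ⇒ₘ β)) (h' : MMTLl T (γ ⇒ₘ δ)) :
    MMTLl T (α &ₘ γ ⇒ₘ β &ₘ δ) :=
  trans (conj_mono_left h) (trans conj_comm (trans (conj_mono_left h') conj_comm))

theorem conj_assoc : MMTLl T ((α &ₘ β) &ₘ γ ⇒ₘ α &ₘ (β &ₘ γ)) :=
  uncurry (uncurry (trans (curry (refl _)) (ofMTL (.ax8 β γ _))))

theorem conj_assoc_symm : MMTLl T (α &ₘ (β &ₘ γ) ⇒ₘ (α &ₘ β) &ₘ γ) :=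
  trans conj_comm (trans (conj_mono_left conj_comm) (trans conj_assoc
    (trans conj_comm (conj_mono_left conj_comm))))

theorem imp_mono (h : MMTLl T (β ⇒ₘ α)) (h' : MMTLl T (γ ⇒ₘ δ)) :
    MMTLl T ((α ⇒ₘ γ) ⇒ₘ (β ⇒ₘ δ)) :=
  trans (.mp h (ofMTL (.ax1 β α γ))) (curry (trans (uncurry (refl _)) h'))

theorem cases_imp (h : MMTLl T ((α ⇒ₘ β) ⇒ₘ γ)) (h' : MMTLl T ((β ⇒ₘ α) ⇒ₘ γ)) : MMTLl T γ :=
  .mp h' (.mp h (ofMTL (.ax9 α β γ)))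

theorem meet_left : MMTLl T (α ⊓ₘ β ⇒ₘ α) := ofMTL (.ax4 α β)

theorem meet_comm : MMTLl T (α ⊓ₘ β ⇒ₘ β ⊓ₘ α) := ofMTL (.ax5 α β)

theorem meet_right : MMTLl T (α ⊓ₘ β ⇒ₘ β) := trans meet_comm meet_left

/-- Prelinearity allows assuming `α ⇒ β` or `β ⇒ α`; divisibility in the form of `ax6` then produces
the meet from the smaller formula alone. -/
theorem imp_meet (h : MMTLl T (γ ⇒ₘ α)) (h' : MMTLl T (γ ⇒ₘ β)) : MMTLl T (γ ⇒ₘ α ⊓ₘ β) :=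
  cases_imp (swap (trans h (curry (ofMTL (.ax6 α β)))))
    (swap (trans h' (curry (trans (ofMTL (.ax6 β α)) meet_comm))))

theorem imp_join_left : MMTLl T (α ⇒ₘ α ⊔ₘ β) :=
  imp_meet (swap (refl _)) (curry conj_left)

theorem imp_join_right : MMTLl T (β ⇒ₘ α ⊔ₘ β) :=
  imp_meet (curry conj_left) (swap (refl _))

theorem join_imp (h : MMTLl T (α ⇒ₘ γ)) (h' : MMTLl T (β ⇒ₘ γ)) : MMTLl T (α ⊔ₘ β ⇒ₘ γ) :=
  cases_imp (swap (trans meet_left (imp_mono (refl _) h')))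
    (swap (trans meet_right (imp_mono (refl _) h)))

theorem prelinear : MMTLl T ((α ⇒ₘ β) ⊔ₘ (β ⇒ₘ α)) :=
  cases_imp imp_join_left imp_join_right

theorem equiv_mp (h : MMTLl T (α ≡ₘ β)) : MMTLl T (α ⇒ₘ β) := .mp h conj_left

theorem equiv_mpr (h : MMTLl T (α ≡ₘ β)) : MMTLl T (β ⇒ₘ α) := .mp h conj_right

/-- Necessitation applies to `□α ⇒ β`, and M3 moves the outer box onto `β`. -/
theorem box_mono (h : MMTLl T (α ⇒ₘ β)) : MMTLl T (□ₘ α ⇒ₘ □ₘ β) :=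
  .mp (.nec (trans (.ax (.m1 α)) h)) (equiv_mp (.ax (.m3 α β)))

theorem mono {S : Set (ModalFormula V)} (hTS : T ⊆ S) (h : MMTLl T α) : MMTLl S α := by
  induction h with
  | ax h => exact .ax h
  | hyp h => exact .hyp (hTS h)
  | mp _ _ h h' => exact .mp h h'
  | nec _ h => exact .nec h
  | disjBox _ h => exact .disjBox h

/-! ### The Lindenbaum algebra of a theory -/

/-- Interderivability of formulas over a theory. -/
def interderivable (T : Set (ModalFormula V)) : Setoid (ULift.{v} (ModalFormula V)) where
  r φ ψ := MMTLl T (φ.down ⇒ₘ ψ.down) ∧ MMTLl T (ψ.down ⇒ₘ φ.down)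
  iseqv := ⟨fun _ => ⟨refl _, refl _⟩, And.symm,
    fun h h' => ⟨trans h.1 h'.1, trans h'.2 h.2⟩⟩

/-- The Lindenbaum algebra of a theory, in an arbitrarily large universe. -/
def Lindenbaum (T : Set (ModalFormula V)) : Type (max u v) := Quotient (interderivable.{u, v} T)

namespace Lindenbaum

/-- The class of a formula in the Lindenbaum algebra. -/
def mk (T : Set (ModalFormula V)) (φ : ModalFormula V) : Lindenbaum.{u, v} T :=
  Quotient.mk _ ⟨φ⟩

theorem ind {p : Lindenbaum.{u, v} T → Prop} (h : ∀ φ, p (mk T φ)) (x) : p x :=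
  Quotient.inductionOn x fun φ => h φ.down

theorem mk_eq_mk (h : MMTLl T (φ ⇒ₘ ψ)) (h' : MMTLl T (ψ ⇒ₘ φ)) :
    mk.{u, v} T φ = mk T ψ :=
  Quotient.sound ⟨h, h'⟩

/-- The binary operation on the Lindenbaum algebra induced by a binary connective. -/
def lift₂ (f : ModalFormula V → ModalFormula V → ModalFormula V)
    (hf : ∀ α α' β β', MMTLl T (α ⇒ₘ α') → MMTLl T (α' ⇒ₘ α) → MMTLl T (β ⇒ₘ β') →
      MMTLl T (β' ⇒ₘ β) → MMTLl T (f α β ⇒ₘ f α' β')) :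
    Lindenbaum.{u, v} T → Lindenbaum.{u, v} T → Lindenbaum.{u, v} T :=
  Quotient.map₂ (fun φ ψ => ⟨f φ.down ψ.down⟩) fun _ _ h _ _ h' =>
    ⟨hf _ _ _ _ h.1 h.2 h'.1 h'.2, hf _ _ _ _ h.2 h.1 h'.2 h'.1⟩

instance : LE (Lindenbaum.{u, v} T) where
  le := Quotient.lift₂ (fun φ ψ => MMTLl T (φ.down ⇒ₘ ψ.down)) fun _ _ _ _ h h' =>
    propext ⟨fun k => trans h.2 (trans k h'.1), fun k => trans h.1 (trans k h'.2)⟩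

theorem mk_le_mk : mk.{u, v} T φ ≤ mk T ψ ↔ MMTLl T (φ ⇒ₘ ψ) := Iff.rfl

instance : Lattice (Lindenbaum.{u, v} T) where
  le_refl := ind fun _ => refl _
  le_trans := ind fun _ => ind fun _ => ind fun _ => trans
  le_antisymm := ind fun _ => ind fun _ => mk_eq_mk
  inf := lift₂ ModalFormula.meet fun _ _ _ _ h _ h' _ =>
    imp_meet (trans meet_left h) (trans meet_right h')
  sup := lift₂ ModalFormula.join fun _ _ _ _ h _ h' _ =>
    join_imp (trans h imp_join_left) (trans h' imp_join_right)
  inf_le_left := ind fun _ => ind fun _ => meet_left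
  inf_le_right := ind fun _ => ind fun _ => meet_right
  le_inf := ind fun _ => ind fun _ => ind fun _ => imp_meet
  le_sup_left := ind fun _ => ind fun _ => imp_join_left
  le_sup_right := ind fun _ => ind fun _ => imp_join_right
  sup_le := ind fun _ => ind fun _ => ind fun _ => join_imp

instance : BoundedOrder (Lindenbaum.{u, v} T) where
  top := mk T (.falsum ⇒ₘ .falsum)
  bot := mk T .falsum
  le_top := ind fun _ => weaken (refl _)
  bot_le := ind fun _ => ofMTL (.ax10 _)

instance : CommMonoid (Lindenbaum.{u, v} T) where
  mul := lift₂ ModalFormula.conj fun _ _ _ _ h _ h' _ => conj_mono h h'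
  one := ⊤
  mul_assoc := ind fun _ => ind fun _ => ind fun _ => mk_eq_mk conj_assoc conj_assoc_symm
  mul_comm := ind fun _ => ind fun _ => mk_eq_mk conj_comm conj_comm
  one_mul := ind fun _ => mk_eq_mk conj_right (.mp (refl _) (curry (refl _)))
  mul_one := ind fun _ => mk_eq_mk conj_left (.mp (refl _) (swap (curry (refl _))))

instance : HImp (Lindenbaum.{u, v} T) where
  himp := lift₂ ModalFormula.imp fun _ _ _ _ _ h h' _ => imp_mono h h'

theorem mk_eq_one : mk.{u, v} T φ = 1 ↔ MMTLl T φ :=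
  ⟨fun h => .mp (refl _) (mk_le_mk.1 (h.ge : (1 : Lindenbaum.{u, v} T) ≤ mk T φ)),
    fun h => mk_eq_mk (weaken (refl _)) (weaken h)⟩

instance : UMTLAlgebra (Lindenbaum.{u, v} T) where
  one_eq_top := rfl
  mul_le_iff_le_himp := ind fun _ => ind fun _ => ind fun _ => ⟨curry, uncurry⟩
  prelinearity := ind fun _ => ind fun _ => mk_eq_one.2 prelinear
  univ := Quotient.map (fun φ => ⟨□ₘ φ.down⟩) fun _ _ h => ⟨box_mono h.1, box_mono h.2⟩
  univ_le := ind fun _ => .ax (.m1 _)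
  univ_himp_himp := ind fun _ => ind fun _ =>
    mk_eq_mk (equiv_mp (.ax (.m2 _ _))) (equiv_mpr (.ax (.m2 _ _)))
  univ_univ_himp := ind fun _ => ind fun _ =>
    mk_eq_mk (equiv_mp (.ax (.m3 _ _))) (equiv_mpr (.ax (.m3 _ _)))

theorem eval_mk (φ : ModalFormula V) :
    φ.eval (fun p => mk.{u, v} T (.var p)) = mk T φ := by
  induction φ with
  | var p => rfl
  | falsum => rfl
  | conj α β hα hβ => rw [ModalFormula.eval, hα, hβ]; rfl
  | meet α β hα hβ => rw [ModalFormula.eval, hα, hβ]; rfl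
  | imp α β hα hβ => rw [ModalFormula.eval, hα, hβ]; rfl
  | box α hα => rw [ModalFormula.eval, hα]; rfl

end Lindenbaum

/-! ### Proof by cases -/

theorem join_mp (h : MMTLl T (χ ⊔ₘ α)) (h' : MMTLl T (χ ⊔ₘ (α ⇒ₘ β))) : MMTLl T (χ ⊔ₘ β) := by
  have hχ : ∀ {γ}, MMTLl T (χ ⇒ₘ γ ⇒ₘ (χ ⊔ₘ β)) := curry (trans conj_left imp_join_left)
  exact .mp h' (.mp h (join_imp hχ (swap (join_imp hχ (imp_mono (refl _) imp_join_right)))))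

theorem join_assoc (h : MMTLl T (α ⊔ₘ (β ⊔ₘ γ))) : MMTLl T ((α ⊔ₘ β) ⊔ₘ γ) :=
  .mp h (join_imp (trans imp_join_left imp_join_left)
    (join_imp (trans imp_join_right imp_join_left) imp_join_right))

theorem join_assoc_symm (h : MMTLl T ((α ⊔ₘ β) ⊔ₘ γ)) : MMTLl T (α ⊔ₘ (β ⊔ₘ γ)) :=
  .mp h (join_imp (join_imp imp_join_left (trans imp_join_left imp_join_right))
    (trans imp_join_right imp_join_right))

/-- Derivations are preserved by disjunction with a fixed formula. -/
theorem join_of_insert (hφ : MMTLl T (χ ⊔ₘ φ)) (h : MMTLl (insert φ T) ψ) :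
    MMTLl T (χ ⊔ₘ ψ) := by
  induction h with
  | ax h => exact .mp (.ax h) imp_join_right
  | hyp h =>
    rcases h with rfl | h
    · exact hφ
    · exact .mp (.hyp h) imp_join_right
  | mp _ _ h h' => exact join_mp h h'
  | nec _ h => exact .disjBox h
  -- The side formula is absorbed into the left disjunct, so the rule applies again.
  | disjBox _ h => exact join_assoc_symm (.disjBox (join_assoc h))

/-- `join_of_insert` is used twice: `φ ⊔ ψ` becomes `φ ⊔ χ` and then `χ ⊔ χ`. -/
theorem proof_by_cases (h : MMTLl T (φ ⊔ₘ ψ)) (hφ : MMTLl (insert φ T) χ)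
    (hψ : MMTLl (insert ψ T) χ) : MMTLl T χ := by
  have h₁ : MMTLl T (χ ⊔ₘ φ) :=
    .mp (join_of_insert h hψ) (join_imp imp_join_right imp_join_left)
  exact .mp (join_of_insert h₁ hφ) (join_imp (refl _) (refl _))

/-! ### Extension to a linear theory -/

/-- Derivations are finite, so a chain has one member containing all the hypotheses used;
nonemptiness covers derivations from axioms alone. -/
theorem exists_of_sUnion {c : Set (Set (ModalFormula V))} (hc : IsChain (· ⊆ ·) c)
    (hne : c.Nonempty) (h : MMTLl (⋃₀ c) φ) : ∃ S ∈ c, MMTLl S φ := by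
  induction h with
  | ax h => exact hne.imp fun S hS => ⟨hS, .ax h⟩
  | hyp h =>
    obtain ⟨S, hS, h⟩ := h
    exact ⟨S, hS, .hyp h⟩
  | mp _ _ h h' =>
    obtain ⟨S, hS, h⟩ := h
    obtain ⟨S', hS', h'⟩ := h'
    rcases hc.total hS hS' with hle | hle
    · exact ⟨S', hS', .mp (mono hle h) h'⟩
    · exact ⟨S, hS, .mp h (mono hle h')⟩
  | nec _ h =>
    obtain ⟨S, hS, h⟩ := h
    exact ⟨S, hS, .nec h⟩
  | disjBox _ h =>
    obtain ⟨S, hS, h⟩ := h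
    exact ⟨S, hS, .disjBox h⟩

/-- A theory not deriving `φ` extends to one that still does not and that derives `α ⇒ β` or
`β ⇒ α` for all `α` and `β`. -/
theorem exists_linear (h : ¬ MMTLl T φ) :
    ∃ S, T ⊆ S ∧ ¬ MMTLl S φ ∧ ∀ α β, MMTLl S (α ⇒ₘ β) ∨ MMTLl S (β ⇒ₘ α) := by
  obtain ⟨S, hTS, hS⟩ := zorn_subset_nonempty {S | ¬ MMTLl S φ}
    (fun c hcs hc hne => ⟨⋃₀ c, fun hφ => by
      obtain ⟨S, hS, hφ⟩ := exists_of_sUnion hc hne hφ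
      exact hcs hS hφ, fun _ => Set.subset_sUnion_of_mem⟩) T h
  refine ⟨S, hTS, hS.prop, fun α β => ?_⟩
  -- Maximality: if `insert ψ S` still failed to derive `φ`, then `ψ` would already lie in `S`.
  have key : ∀ ψ, ¬ MMTLl S ψ → MMTLl (insert ψ S) φ := fun ψ hψ => by
    by_contra hφ
    exact hψ (.hyp (hS.le_of_ge hφ (Set.subset_insert ψ S) (Set.mem_insert ψ S)))
  by_contra! hαβ
  exact hS.prop (proof_by_cases prelinear (key _ hαβ.1) (key _ hαβ.2))

end MMTLl

/-! ### Soundness -/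

section Soundness

variable {L : Type w}

namespace MTLAlgebra

variable [MTLAlgebra L] {x y z : L}

theorem himp_eq_one_iff : x ⇨ y = 1 ↔ x ≤ y := by
  rw [one_eq_top, ← top_le_iff, ← one_eq_top, ← mul_le_iff_le_himp, one_mul]

theorem himp_mul_le : (x ⇨ y) * x ≤ y := (mul_le_iff_le_himp _ _ _).2 le_rfl

theorem mul_mono {x' y' : L} (h : x ≤ x') (h' : y ≤ y') : x * y ≤ x' * y' := by
  have key : ∀ {a b c : L}, a ≤ b → a * c ≤ b * c := fun hab =>
    (mul_le_iff_le_himp _ _ _).2 (hab.trans ((mul_le_iff_le_himp _ _ _).1 le_rfl))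
  calc x * y ≤ x' * y := key h
    _ = y * x' := mul_comm _ _
    _ ≤ y' * x' := key h'
    _ = x' * y' := mul_comm _ _

theorem mul_le_left : x * y ≤ x := by
  simpa using mul_mono (le_refl x) (one_eq_top (L := L) ▸ le_top : y ≤ 1)

theorem le_one : x ≤ 1 := one_eq_top (L := L) ▸ le_top

theorem eq_one_iff : x = 1 ↔ 1 ≤ x := ⟨fun h => h.ge, le_one.antisymm⟩

theorem one_himp : (1 : L) ⇨ x = x := by
  apply le_antisymm
  · simpa using himp_mul_le (x := (1 : L)) (y := x)
  · rw [← mul_le_iff_le_himp, mul_one]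

theorem equiv_self : (x ⇨ x) * (x ⇨ x) = 1 := by
  rw [himp_eq_one_iff.2 le_rfl, one_mul]

/-- If `x ≤ y`, the first factor `(x ⇨ y) ⇨ y` is `1 ⇨ y = y`; symmetrically for `y ≤ x`. -/
theorem join_eq_one_iff (hL : ∀ x y : L, x ≤ y ∨ y ≤ x) :
    ((x ⇨ y) ⇨ y) ⊓ ((y ⇨ x) ⇨ x) = 1 ↔ x = 1 ∨ y = 1 := by
  rw [eq_one_iff, le_inf_iff, ← eq_one_iff, ← eq_one_iff, himp_eq_one_iff, himp_eq_one_iff]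
  constructor
  · rintro ⟨h, h'⟩
    rcases hL x y with hxy | hxy
    · rw [himp_eq_one_iff.2 hxy] at h
      exact .inr (eq_one_iff.2 h)
    · rw [himp_eq_one_iff.2 hxy] at h'
      exact .inl (eq_one_iff.2 h')
  · rintro (rfl | rfl)
    · exact ⟨one_himp.le, le_one⟩
    · exact ⟨le_one, one_himp.le⟩

end MTLAlgebra

open MTLAlgebra

theorem UMTLAlgebra.univ_one [UMTLAlgebra L] : univ (1 : L) = 1 := by
  have h := univ_univ_himp (1 : L) 1
  rwa [himp_eq_one_iff.2 le_one, himp_eq_one_iff.2 le_rfl] at h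

variable {V : Type u}

theorem MTLAxiom.eval_eq_one [UMTLAlgebra L] (hL : ∀ x y : L, x ≤ y ∨ y ≤ x) (e : V → L)
    {α : ModalFormula V} (h : MTLAxiom α) : α.eval e = 1 := by
  cases h <;> simp only [ModalFormula.eval, himp_eq_one_iff]
  case ax1 α β γ =>
    rw [← mul_le_iff_le_himp, ← mul_le_iff_le_himp, mul_comm (_ ⇨ _) (_ ⇨ _), mul_assoc]
    exact (mul_mono le_rfl himp_mul_le).trans himp_mul_le
  case ax2 => exact mul_le_left
  case ax3 => exact (mul_comm _ _).le
  case ax4 => exact inf_le_left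
  case ax5 => exact (inf_comm _ _).le
  case ax6 => exact le_inf mul_le_left ((mul_comm _ _).le.trans himp_mul_le)
  case ax7 =>
    rw [← mul_le_iff_le_himp, ← mul_assoc]
    exact (mul_mono himp_mul_le le_rfl).trans himp_mul_le
  case ax8 =>
    rw [← mul_le_iff_le_himp, ← mul_le_iff_le_himp, mul_assoc]
    exact himp_mul_le
  case ax9 α β γ =>
    rw [← mul_le_iff_le_himp]
    rcases hL (α.eval e) (β.eval e) with h | h
    · rw [himp_eq_one_iff.2 h, one_himp]
      exact mul_le_left
    · rw [himp_eq_one_iff.2 h, one_himp, mul_comm]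
      exact mul_le_left
  case ax10 => exact bot_le

theorem MMTLAxiom.eval_eq_one [UMTLAlgebra L] (hL : ∀ x y : L, x ≤ y ∨ y ≤ x) (e : V → L)
    {α : ModalFormula V} (h : MMTLAxiom α) : α.eval e = 1 := by
  cases h with
  | mtl h => exact h.eval_eq_one hL e
  | m1 α => exact himp_eq_one_iff.2 (UMTLAlgebra.univ_le _)
  | m2 α β =>
    simp only [ModalFormula.equiv, ModalFormula.eval, UMTLAlgebra.univ_himp_himp, equiv_self]
  | m3 α β =>
    simp only [ModalFormula.equiv, ModalFormula.eval, UMTLAlgebra.univ_univ_himp, equiv_self]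

theorem MMTLl.eval_eq_one [UMTLAlgebra L] (hL : ∀ x y : L, x ≤ y ∨ y ≤ x) {e : V → L}
    {T : Set (ModalFormula V)} (he : ModalFormula.IsModel e T) {α : ModalFormula V}
    (h : MMTLl T α) : α.eval e = 1 := by
  induction h with
  | ax h => exact h.eval_eq_one hL e
  | hyp h => exact he _ h
  | mp _ _ h h' =>
    rwa [ModalFormula.eval, h, one_himp] at h'
  | nec _ h => rw [ModalFormula.eval, h, UMTLAlgebra.univ_one]
  | disjBox _ h =>
    refine (join_eq_one_iff hL).2 (((join_eq_one_iff hL).1 h).imp id fun h => ?_)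
    rw [ModalFormula.eval, h, UMTLAlgebra.univ_one]

end Soundness

theorem theorem5p6 {V : Type u} (T : Set (ModalFormula V)) (α : ModalFormula V) :
    MMTLl T α ↔
      ∀ (L : Type (max u v)) [UMTLAlgebra L], (∀ x y : L, x ≤ y ∨ y ≤ x) →
        ∀ e : V → L, ModalFormula.IsModel e T → ModalFormula.eval e α = 1 := by
  refine ⟨fun h L _ hL e he => h.eval_eq_one hL he, fun h => ?_⟩
  by_contra hα
  obtain ⟨S, hTS, hS, hlin⟩ := MMTLl.exists_linear hα
  -- The countermodel is the Lindenbaum algebra of `S`, lifted to the universe of the algebras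
  -- quantified over, with each variable sent to its class.
  refine hS (MMTLl.Lindenbaum.mk_eq_one.{u, v}.1 ?_)
  rw [← MMTLl.Lindenbaum.eval_mk]
  refine h _ (MMTLl.Lindenbaum.ind fun φ =>
    MMTLl.Lindenbaum.ind fun ψ => hlin φ ψ) _ fun ψ hψ => ?_
  rw [MMTLl.Lindenbaum.eval_mk, MMTLl.Lindenbaum.mk_eq_one]
  exact .hyp (hTS hψ)
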